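/- All logarithms are natural. For a probability distribution $\mu$ on $\mathbb{N}$ and $\alpha>0$ put $$H_\alpha(\mu)=\sum_{j:\mu(j)>0}\mu(j)\,|\log\mu(j)|^\alpha\in[0,\infty],\qquad H=H_1 .$$ For $\alpha,h>0$ and an integer $n\ge1$, the $L_1$ minimax risk of entropy estimation is $$\mathcal R_n^{(\alpha)}(h)=\inf_{\hat H}\ \sup_{\mu:\,H_\alpha(\mu)\le h}\ \mathbb E\,\bigl|\hat H(X_1,\dots,X_n)-H(\mu)\bigr| ,$$ where $X_1,\dots,X_n$ are independent with law $\mu$ and the infimum is over all maps $\hat H:\mathbb N^n\to[0,\infty)$. Let $\hat\mu_n(j)=\frac1n\#\{i\le n: X_i=j\}$ denote the empirical measure. **Theorem.** (a) For all $h>0$, $\alpha>1$ and $n\ge1$, $$\mathcal R_n^{(\alpha)}(h)\ \le\ \frac{1+\log n}{\sqrt n}+\frac{2^{\alpha-1}h}{\log^{\alpha-1}n}$$ (the right-hand side being $+\infty$ for $n=1$), and this bound is achieved by the plug-in estimator $H(\hat\mu_n)$, that is, $$\sup_{\mu:\,H_\alpha(\mu)\le h}\mathbb E\,\bigl|H(\hat\mu_n)-H(\mu)\bigr|\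 \le\ \frac{1+\log n}{\sqrt n}+\frac{2^{\alpha-1}h}{\log^{\alpha-1}n}.$$ (b) For each $\alpha>0$ and each integer $n\ge1$, except when $n=1$ and $\alpha>1$, there is an $h>0$ such that $$\mathcal R_n^{(\alpha)}(h)\ \ge\ \frac{h}{4\cdot3^\alpha\log^{\alpha-1}n}$$ (for $n=1$ the right-hand side is read as $h/12$ if $\alpha=1$ and as $0$ if $\alpha<1$). -/

import Mathlib

open scoped ENNReal NNReal

namespace EntropyEstimation

/-- The `α`-th moment of information `H_α(ξ) = ∑_{j : ξ(j) > 0} ξ(j) |log ξ(j)|^α` of a function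
`ξ : ℕ → ℝ₊`, with values in `[0, ∞]`. Terms with `ξ(j) = 0` vanish because of the factor `ξ(j)`. -/
noncomputable def infoMoment (α : ℝ) (ξ : ℕ → ℝ≥0) : ℝ≥0∞ :=
  ∑' j : ℕ, ENNReal.ofReal ((ξ j : ℝ) * |Real.log (ξ j : ℝ)| ^ α)

/-- The Shannon entropy `H(ξ) = H_1(ξ)` (natural logarithm), with values in `[0, ∞]`. -/
noncomputable def entropy (ξ : ℕ → ℝ≥0) : ℝ≥0∞ :=
  infoMoment 1 ξ

/-- The mass function `ℕ → ℝ₊` of a probability distribution on `ℕ`. -/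
noncomputable def mass (μ : PMF ℕ) : ℕ → ℝ≥0 :=
  fun j => (μ j).toNNReal

/-- The class of all probability distributions `μ` on `ℕ` with `H_α(μ) ≤ h`. -/
def boundedMoment (α h : ℝ) : Set (PMF ℕ) :=
  {μ | infoMoment α (mass μ) ≤ ENNReal.ofReal h}

/-- The distance `|a - b|` of two extended nonnegative numbers (subtraction in `ℝ≥0∞` is truncated,
so one of the two summands is zero; the value is `∞` if exactly one of `a`, `b` is infinite). -/
noncomputable def absDiff (a b : ℝ≥0∞) : ℝ≥0∞ :=
  (a - b) + (b - a)

/-- The `L₁` risk `𝔼 |Ĥ(X₁, …, Xₙ) - H(μ)|` of an estimator `Ĥ : ℕⁿ → ℝ₊` at `μ`, where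
`X₁, …, Xₙ` are drawn independently from `μ`. -/
noncomputable def risk {n : ℕ} (Hhat : (Fin n → ℕ) → ℝ≥0) (μ : PMF ℕ) : ℝ≥0∞ :=
  ∫⁻ x, absDiff (Hhat x : ℝ≥0∞) (entropy (mass μ))
    ∂(MeasureTheory.Measure.pi fun _ : Fin n => μ.toMeasure)

/-- The worst-case `L₁` risk of an estimator over all distributions `μ` with `H_α(μ) ≤ h`. -/
noncomputable def worstCaseRisk {n : ℕ} (α h : ℝ) (Hhat : (Fin n → ℕ) → ℝ≥0) : ℝ≥0∞ :=
  ⨆ μ ∈ boundedMoment α h, risk Hhat μ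

/-- The `L₁` minimax risk: the infimum, over all mappings `Ĥ : ℕⁿ → ℝ₊`, of the worst-case risk. -/
noncomputable def minimaxRisk (n : ℕ) (α h : ℝ) : ℝ≥0∞ :=
  ⨅ Hhat : (Fin n → ℕ) → ℝ≥0, worstCaseRisk α h Hhat

/-- The empirical measure `μ̂ₙ(j) = (1/n) #{i : xᵢ = j}` of a sample. -/
noncomputable def empirical {n : ℕ} (x : Fin n → ℕ) : ℕ → ℝ≥0 :=
  fun j => ((Finset.univ.filter fun i => x i = j).card : ℝ≥0) / n

/-- The plug-in estimator `H(μ̂ₙ)`. -/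
noncomputable def plugIn {n : ℕ} (x : Fin n → ℕ) : ℝ≥0 :=
  (entropy (empirical x)).toNNReal

/-- The entropy of an empirical measure is finite, so nothing is lost in `plugIn`. -/
theorem coe_plugIn {n : ℕ} (x : Fin n → ℕ) :
    (plugIn x : ℝ≥0∞) = entropy (empirical x) := by
  refine ENNReal.coe_toNNReal ?_
  unfold entropy infoMoment
  rw [tsum_eq_sum (s := Finset.univ.image x)]
  · exact ENNReal.sum_ne_top.2 fun j _ => ENNReal.ofReal_ne_top
  · intro j hj
    have h0 : empirical x j = 0 := by
      have h1 : (Finset.univ.filter fun i => x i = j) = ∅ := by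
        ext i
        simp only [Finset.mem_image, Finset.mem_univ, true_and, not_exists] at hj
        simp [hj i]
      simp [empirical, h1]
    simp [h0]

end EntropyEstimation

/-! For (a), the error of the plug-in estimator is split at its mean. One observation moves `plugIn`
by at most 2 log n / n (`plugIn_update_sub_le`), so bounded differences give variance at most (log
n)² / n and L₁ deviation at most log n / √n. The bias is treated symbol by symbol. Concavity of -x
log x makes it nonpositive. A parabola touching -x log x from below at p, integrated with two
moments of the empirical frequency, shows that a symbol of mass p > 0 loses at most 1/n. For p ≥
1/√n this is at most p/√n, which sums to at most 1/√n. For smaller p, |log p| ≥ (log n)/2, and the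
whole entropy term is absorbed by the α-th moment.

For (b), the point mass at 0 is compared with a `spike` of mass 1 - 1/(2n) at 0. Both produce the
all-zero sample with probability at least 1/2, which forces risk at least H/4. Taking h to be the
α-th moment of the spike, it remains to choose the number m of light symbols so that H_α ≤ 3^α (log
n)^(α-1) H (`exists_width`). -/

namespace EntropyEstimation

open MeasureTheory ProbabilityTheory

/-! ### Variance under bounded differences -/

/-- A random variable whose values are pairwise within distance `c` has variance at most
`(c / 2) ^ 2`. -/
theorem variance_le_of_oscillation {Ω : Type*} [MeasurableSpace Ω] (ν : Measure Ω)
    [IsProbabilityMeasure ν] {f : Ω → ℝ} (hf : Measurable f) {c : ℝ}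
    (hc : ∀ a b, f a - f b ≤ c) : variance f ν ≤ (c / 2) ^ 2 := by
  have : Nonempty Ω := nonempty_of_isProbabilityMeasure ν
  obtain ⟨a₀⟩ := this
  have hbdd : BddBelow (Set.range f) :=
    ⟨f a₀ - c, by rintro _ ⟨b, rfl⟩; linarith [hc a₀ b]⟩
  have h := variance_le_sq_of_bounded (μ := ν) (X := f) (a := ⨅ b, f b) (b := (⨅ b, f b) + c)
    (Filter.Eventually.of_forall fun a => ⟨ciInf_le hbdd a, by
      have : Nonempty Ω := ⟨a₀⟩
      have : f a - c ≤ ⨅ b, f b := le_ciInf fun b => by linarith [hc a b]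
      linarith⟩) hf.aemeasurable
  simpa using h

theorem abs_integral_le_of_abs_le {Ω : Type*} [MeasurableSpace Ω] (ν : Measure Ω)
    [IsProbabilityMeasure ν] {f : Ω → ℝ} {C : ℝ} (hC : ∀ a, |f a| ≤ C) : |∫ a, f a ∂ν| ≤ C := by
  have := norm_integral_le_of_norm_le_const (μ := ν) (f := f) (C := C)
    (Filter.Eventually.of_forall hC)
  simpa using this

/-- A function of a product of two probability spaces: the variance is at most the variance of the
conditional mean plus a bound for the conditional variances. -/
theorem variance_prod_le {Ω Ω' : Type*} [MeasurableSpace Ω] [MeasurableSpace Ω'] (ν : Measure Ω)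
    [IsProbabilityMeasure ν] (ρ : Measure Ω') [IsProbabilityMeasure ρ] {F : Ω × Ω' → ℝ}
    (hF : Measurable F) {C v : ℝ} (hC : ∀ z, |F z| ≤ C)
    (hv : ∀ y, variance (fun a => F (a, y)) ν ≤ v) :
    variance F (ν.prod ρ) ≤ v + variance (fun y => ∫ a, F (a, y) ∂ν) ρ := by
  have hGm : StronglyMeasurable (fun y => ∫ a, F (a, y) ∂ν) :=
    StronglyMeasurable.integral_prod_left' (μ := ν) hF.stronglyMeasurable
  have hLF : MemLp F 2 (ν.prod ρ) := MemLp.of_bound hF.aestronglyMeasurable C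
    (Filter.Eventually.of_forall hC)
  have hLG : MemLp (fun y => ∫ a, F (a, y) ∂ν) 2 ρ :=
    MemLp.of_bound hGm.aestronglyMeasurable C (Filter.Eventually.of_forall fun y =>
      abs_integral_le_of_abs_le ν fun a => hC (a, y))
  have hLy (y : Ω') : MemLp (fun a => F (a, y)) 2 ν :=
    MemLp.of_bound (hF.comp measurable_prodMk_right).aestronglyMeasurable C
      (Filter.Eventually.of_forall fun a => hC (a, y))
  rw [variance_eq_sub hLF, variance_eq_sub hLG]
  have h1 : ∫ z, F z ∂(ν.prod ρ) = ∫ y, ∫ a, F (a, y) ∂ν ∂ρ :=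
    integral_prod_symm _ (hLF.integrable one_le_two)
  have h2 : ∫ z, F z ^ 2 ∂(ν.prod ρ) = ∫ y, ∫ a, F (a, y) ^ 2 ∂ν ∂ρ :=
    integral_prod_symm _ hLF.integrable_sq
  have h3 : ∫ y, ∫ a, F (a, y) ^ 2 ∂ν ∂ρ ≤ ∫ y, (v + (∫ a, F (a, y) ∂ν) ^ 2) ∂ρ := by
    refine integral_mono hLF.integrable_sq.integral_prod_right
      ((integrable_const v).add hLG.integrable_sq) fun y => ?_
    have := hv y
    rw [variance_eq_sub (hLy y)] at this
    simp only [Pi.pow_apply] at this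
    linarith
  rw [integral_add (integrable_const v) hLG.integrable_sq] at h3
  simp only [Pi.pow_apply, integral_const, probReal_univ, smul_eq_mul, one_mul] at h3 ⊢
  rw [h1, h2]
  linarith

/-- The variance form of the bounded differences inequality. -/
theorem variance_pi_le_of_bounded_differences {Ω : Type*} [MeasurableSpace Ω] (ν : Measure Ω)
    [IsProbabilityMeasure ν] {C c : ℝ} (n : ℕ) (f : (Fin n → Ω) → ℝ) (hf : Measurable f)
    (hC : ∀ x, |f x| ≤ C) (hc : ∀ x i a, f (Function.update x i a) - f x ≤ c) :
    variance f (Measure.pi fun _ : Fin n => ν) ≤ n * (c / 2) ^ 2 := by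
  induction n with
  | zero =>
    have := variance_le_of_oscillation (Measure.pi fun _ : Fin 0 => ν) hf (c := 0)
      fun a b => by rw [Subsingleton.elim a b]; simp
    simpa using this
  | succ n ih =>
    have mp := measurePreserving_piFinSuccAbove (fun _ : Fin (n + 1) => ν) 0
    set e := MeasurableEquiv.piFinSuccAbove (fun _ : Fin (n + 1) => Ω) 0 with he
    have hsymm : ∀ a y, e.symm (a, y) = Fin.cons a y := fun a y => by
      simp [he, MeasurableEquiv.piFinSuccAbove, Fin.insertNthEquiv]
    have hF : Measurable (f ∘ e.symm) := hf.comp e.symm.measurable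
    have hvar : variance f (Measure.pi fun _ : Fin (n + 1) => ν) =
        variance (f ∘ e.symm) (ν.prod (Measure.pi fun _ : Fin n => ν)) := by
      rw [← mp.variance_fun_comp hF.aemeasurable]
      simp
    rw [hvar]
    -- Given the other coordinates, coordinate 0 moves `f` by at most `c`, which costs `(c / 2) ^
    -- 2`. Averaging over it preserves the bounded differences, so induction handles the conditional
    -- mean.
    refine (variance_prod_le ν _ hF (C := C) (v := (c / 2) ^ 2) (fun z => hC _) fun y => ?_).trans ?_
    · refine variance_le_of_oscillation ν (hF.comp measurable_prodMk_right) fun a b => ?_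
      have := hc (Fin.cons b y) 0 a
      simpa [hsymm, Fin.update_cons_zero] using this
    · have hint (y : Fin n → Ω) : Integrable (fun a => (f ∘ e.symm) (a, y)) ν :=
        Integrable.of_bound (hF.comp measurable_prodMk_right).aestronglyMeasurable C
          (Filter.Eventually.of_forall fun a => hC _)
      have := ih (fun y => ∫ a, (f ∘ e.symm) (a, y) ∂ν)
        (StronglyMeasurable.integral_prod_left' (μ := ν) hF.stronglyMeasurable).measurable
        (fun y => abs_integral_le_of_abs_le ν fun a => hC _) (fun y i b => ?_)
      · push_cast
        linarith
      · rw [← integral_sub (hint _) (hint _)]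
        have h : ∫ a, ((f ∘ e.symm) (a, Function.update y i b) - (f ∘ e.symm) (a, y)) ∂ν ≤
            ∫ _, c ∂ν := by
          refine integral_mono ((hint _).sub (hint _)) (integrable_const c) fun a => ?_
          have := hc (Fin.cons a y) i.succ b
          simpa [hsymm, Fin.cons_update] using this
        simpa using h

/-- The mean absolute deviation is at most the standard deviation. -/
theorem integral_abs_sub_le_sqrt_variance {Ω : Type*} [MeasurableSpace Ω] (ν : Measure Ω)
    [IsProbabilityMeasure ν] {f : Ω → ℝ} (hf : MemLp f 2 ν) :
    ∫ a, |f a - ∫ b, f b ∂ν| ∂ν ≤ √(variance f ν) := by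
  have hm : MemLp (fun a => |f a - ∫ b, f b ∂ν|) 2 ν := (hf.sub (memLp_const _)).abs
  have h0 := variance_nonneg (fun a => |f a - ∫ b, f b ∂ν|) ν
  rw [variance_eq_sub hm] at h0
  rw [variance_eq_integral hf.aestronglyMeasurable.aemeasurable]
  refine Real.le_sqrt_of_sq_le ?_
  simpa [sq_abs] using h0

/-! ### Sensitivity of the plug-in estimator to one observation -/

theorem entropy_term {p : ℝ} (h0 : 0 ≤ p) (h1 : p ≤ 1) :
    p * |Real.log p| ^ (1 : ℝ) = Real.negMulLog p := by
  rw [Real.rpow_one, abs_of_nonpos (Real.log_nonpos h0 h1), Real.negMulLog]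
  ring

theorem entropy_eq_tsum {ξ : ℕ → ℝ≥0} (h : ∀ j, ξ j ≤ 1) :
    entropy ξ = ∑' j, ENNReal.ofReal (Real.negMulLog (ξ j)) := by
  unfold entropy infoMoment
  congr 1
  ext j
  rw [entropy_term (ξ j).coe_nonneg (by exact_mod_cast h j)]

/-- The number of occurrences of `j` in a sample. -/
def count {n : ℕ} (x : Fin n → ℕ) (j : ℕ) : ℕ :=
  (Finset.univ.filter fun i => x i = j).card

theorem coe_empirical {n : ℕ} (x : Fin n → ℕ) (j : ℕ) :
    (empirical x j : ℝ) = (count x j : ℝ) / n := by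
  simp [empirical, count]

theorem count_le {n : ℕ} (x : Fin n → ℕ) (j : ℕ) : count x j ≤ n := by
  simpa [count] using Finset.card_filter_le (Finset.univ : Finset (Fin n)) fun i => x i = j

theorem empirical_le_one {n : ℕ} (x : Fin n → ℕ) (j : ℕ) : empirical x j ≤ 1 := by
  rw [← NNReal.coe_le_coe, coe_empirical]
  exact div_le_one_of_le₀ (by exact_mod_cast count_le x j) (Nat.cast_nonneg n)

theorem count_eq_zero {n : ℕ} {x : Fin n → ℕ} {j : ℕ} (h : j ∉ Finset.univ.image x) :
    count x j = 0 := by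
  simp only [Finset.mem_image, Finset.mem_univ, true_and, not_exists] at h
  simp [count, h]

theorem coe_plugIn_eq_sum {n : ℕ} {x : Fin n → ℕ} {S : Finset ℕ} (hS : Finset.univ.image x ⊆ S) :
    (plugIn x : ℝ) = ∑ j ∈ S, Real.negMulLog (count x j / n) := by
  have h0 : ∀ j, 0 ≤ Real.negMulLog (count x j / n) := fun j => by
    rw [← coe_empirical]
    exact Real.negMulLog_nonneg (empirical x j).coe_nonneg (by exact_mod_cast empirical_le_one x j)
  have : (plugIn x : ℝ≥0∞) = ENNReal.ofReal (∑ j ∈ S, Real.negMulLog (count x j / n)) := by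
    rw [coe_plugIn, entropy_eq_tsum (empirical_le_one x), tsum_eq_sum (s := S),
      ENNReal.ofReal_sum_of_nonneg fun j _ => h0 j]
    · simp_rw [coe_empirical]
    · intro j hj
      simp [coe_empirical, count_eq_zero fun h => hj (hS h)]
  rw [← ENNReal.coe_toReal (plugIn x), this, ENNReal.toReal_ofReal (Finset.sum_nonneg fun j _ => h0 j)]

/-- The additive form avoids truncated subtraction and also covers `x i = b`. -/
theorem count_update {n : ℕ} (x : Fin n → ℕ) (i : Fin n) (b j : ℕ) :
    count (Function.update x i b) j + (if x i = j then 1 else 0) =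
      count x j + (if b = j then 1 else 0) := by
  have key : ∀ y : Fin n → ℕ, count y j =
      (∑ k ∈ Finset.univ.erase i, if y k = j then 1 else 0) + if y i = j then 1 else 0 := by
    intro y
    rw [Finset.sum_erase_add _ _ (Finset.mem_univ i), count, Finset.card_filter]
  rw [key x, key (Function.update x i b), Function.update_self]
  have : (∑ k ∈ Finset.univ.erase i, if Function.update x i b k = j then 1 else 0) =
      ∑ k ∈ Finset.univ.erase i, if x k = j then 1 else 0 := by
    refine Finset.sum_congr rfl fun k hk => ?_
    rw [Function.update_of_ne (Finset.ne_of_mem_erase hk)]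
  omega

/-- The increments of `k ↦ k log k` are nonnegative. -/
theorem mul_log_le_succ (k : ℕ) :
    (k : ℝ) * Real.log k ≤ ((k + 1 : ℕ) : ℝ) * Real.log (k + 1 : ℕ) := by
  rcases Nat.eq_zero_or_pos k with rfl | hk
  · simp
  · have hk' : (1 : ℝ) ≤ k := by exact_mod_cast hk
    have h1 : Real.log k ≤ Real.log (k + 1 : ℕ) :=
      Real.log_le_log (by positivity) (by push_cast; linarith)
    exact mul_le_mul (by push_cast; linarith) h1 (Real.log_nonneg hk') (by positivity)

/-- For k ≥ 1 the claim rearranges to (k - 1) log(k + 1) ≤ k log k, which follows from log(1 + 1/k)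
≤ 1/k and 1 - 1/k ≤ log k. -/
theorem succ_mul_log_sub_le (k : ℕ) :
    ((k + 1 : ℕ) : ℝ) * Real.log (k + 1 : ℕ) - (k : ℝ) * Real.log k ≤
      2 * Real.log (k + 1 : ℕ) := by
  rcases Nat.eq_zero_or_pos k with rfl | hk
  · simp
  · have hk' : (1 : ℝ) ≤ k := by exact_mod_cast hk
    have hk0 : (0 : ℝ) < k := by linarith
    have h1 : Real.log (k + 1 : ℕ) ≤ Real.log k + (k : ℝ)⁻¹ := by
      have : ((k + 1 : ℕ) : ℝ) = k * (1 + (k : ℝ)⁻¹) := by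
        push_cast
        field_simp
      rw [this, Real.log_mul hk0.ne' (by positivity)]
      have := Real.log_le_sub_one_of_pos (show 0 < 1 + (k : ℝ)⁻¹ by positivity)
      linarith
    have h2 := Real.one_sub_inv_le_log_of_pos hk0
    have h3 : ((k : ℝ) - 1) * Real.log (k + 1 : ℕ) ≤ (k - 1) * (Real.log k + (k : ℝ)⁻¹) :=
      mul_le_mul_of_nonneg_left h1 (by linarith)
    have h4 : ((k : ℝ) - 1) * (k : ℝ)⁻¹ = 1 - (k : ℝ)⁻¹ := by field_simp
    push_cast at *
    linarith [mul_add ((k : ℝ) - 1) (Real.log k) (k : ℝ)⁻¹]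

theorem negMulLog_div_succ_sub {n : ℕ} (hn : 0 < n) (k : ℕ) :
    Real.negMulLog ((k + 1 : ℕ) / n) - Real.negMulLog ((k : ℝ) / n) =
      (Real.log n - (((k + 1 : ℕ) : ℝ) * Real.log (k + 1 : ℕ) - k * Real.log k)) / n := by
  have hn' : (n : ℝ) ≠ 0 := by positivity
  have key : ∀ m : ℕ, Real.negMulLog ((m : ℝ) / n) = (m * Real.log n - m * Real.log m) / n := by
    intro m
    rcases Nat.eq_zero_or_pos m with rfl | hm
    · simp
    · rw [Real.negMulLog, Real.log_div (by positivity) hn']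
      ring
  rw [key, key]
  push_cast
  ring

/-- Changing one observation changes the plug-in estimator by at most `2 log n / n`. -/
theorem plugIn_update_sub_le {n : ℕ} (x : Fin n → ℕ) (i : Fin n) (b : ℕ) :
    (plugIn (Function.update x i b) : ℝ) - plugIn x ≤ 2 * Real.log n / n := by
  have hn : 0 < n := i.pos
  have hn' : (0 : ℝ) < n := by exact_mod_cast hn
  have hlog : 0 ≤ Real.log n := Real.log_nonneg (by exact_mod_cast hn)
  by_cases hab : x i = b
  · rw [← hab, Function.update_eq_self]
    have : 0 ≤ 2 * Real.log n / n := by positivity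
    linarith
  set x' := Function.update x i b with hx'
  set S := Finset.univ.image x ∪ Finset.univ.image x'
  have ha : x i ∈ S := Finset.mem_union_left _ (Finset.mem_image_of_mem _ (Finset.mem_univ i))
  have hb : b ∈ S := Finset.mem_union_right _
    (Finset.mem_image.2 ⟨i, Finset.mem_univ i, by simp [hx']⟩)
  rw [coe_plugIn_eq_sum (x := x') (S := S) Finset.subset_union_right,
    coe_plugIn_eq_sum (x := x) (S := S) Finset.subset_union_left, ← Finset.sum_sub_distrib,
    ← Finset.sum_subset (s₁ := {x i, b}) (by
      intro j hj
      simp only [Finset.mem_insert, Finset.mem_singleton] at hj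
      rcases hj with rfl | rfl <;> assumption), Finset.sum_pair hab]
  · obtain ⟨k, hk⟩ : ∃ k, count x' (x i) = k := ⟨_, rfl⟩
    obtain ⟨l, hl⟩ : ∃ l, count x b = l := ⟨_, rfl⟩
    have h1 : count x (x i) = k + 1 := by
      have := count_update x i b (x i)
      rw [if_pos rfl, if_neg (Ne.symm hab), ← hx', hk] at this
      omega
    have h2 : count x' b = l + 1 := by
      have := count_update x i b b
      rw [if_pos rfl, if_neg hab, ← hx', hl] at this
      omega
    have h3 : k + 1 ≤ n := h1 ▸ count_le x _
    -- One count falls from k + 1 to k, another rises from l to l + 1. The two log n terms cancel,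
    -- leaving the increment of t log t at k minus that at l, over n.
    rw [hk, hl, h1, h2, ← neg_sub (Real.negMulLog (((k + 1 : ℕ) : ℝ) / n)),
      negMulLog_div_succ_sub hn, negMulLog_div_succ_sub hn]
    have h4 := succ_mul_log_sub_le k
    have h5 := mul_log_le_succ l
    have h6 : Real.log (k + 1 : ℕ) ≤ Real.log n :=
      Real.log_le_log (by positivity) (by exact_mod_cast h3)
    rw [← neg_div, ← add_div]
    gcongr
    linarith
  · intro j _ hj
    simp only [Finset.mem_insert, Finset.mem_singleton, not_or] at hj
    have := count_update x i b j
    rw [if_neg (Ne.symm hj.1), if_neg (Ne.symm hj.2), ← hx'] at this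
    simp only [add_zero] at this
    rw [this, sub_self]

/-- A crude bound, used only for integrability. -/
theorem plugIn_le {n : ℕ} (x : Fin n → ℕ) : (plugIn x : ℝ) ≤ n := by
  rw [coe_plugIn_eq_sum (Finset.Subset.refl _)]
  have h1 : ∀ p : ℝ, 0 ≤ p → Real.negMulLog p ≤ 1 := by
    intro p hp
    rcases hp.eq_or_lt with rfl | hp
    · simp
    · have := Real.one_sub_inv_le_log_of_pos hp
      have h2 : p * (1 - p⁻¹) ≤ p * Real.log p := mul_le_mul_of_nonneg_left this hp.le
      rw [mul_sub, mul_inv_cancel₀ hp.ne'] at h2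
      rw [Real.negMulLog]
      linarith
  calc ∑ j ∈ Finset.univ.image x, Real.negMulLog (count x j / n)
      ≤ ∑ _j ∈ Finset.univ.image x, (1 : ℝ) := Finset.sum_le_sum fun j _ => h1 _ (by positivity)
    _ ≤ n := by
      simp only [Finset.sum_const, nsmul_eq_mul, mul_one]
      exact_mod_cast Finset.card_image_le.trans (by simp)

/-- The plug-in estimator deviates from its mean by at most `log n / √n`, in `L₁`. -/
theorem integral_abs_plugIn_sub_le {n : ℕ} (hn : 0 < n) (ν : Measure ℕ) [IsProbabilityMeasure ν] :
    ∫ x, |(plugIn x : ℝ) - ∫ y, (plugIn y : ℝ) ∂(Measure.pi fun _ : Fin n => ν)|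
      ∂(Measure.pi fun _ : Fin n => ν) ≤ Real.log n / √n := by
  have hm : Measurable fun x : Fin n → ℕ => (plugIn x : ℝ) := Measurable.of_discrete
  have hC : ∀ x : Fin n → ℕ, |(plugIn x : ℝ)| ≤ n := fun x => by
    rw [abs_of_nonneg (plugIn x).coe_nonneg]
    exact plugIn_le x
  have hL : MemLp (fun x : Fin n → ℕ => (plugIn x : ℝ)) 2 (Measure.pi fun _ : Fin n => ν) :=
    MemLp.of_bound hm.aestronglyMeasurable n (Filter.Eventually.of_forall hC)
  refine (integral_abs_sub_le_sqrt_variance _ hL).trans ?_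
  have hlog : 0 ≤ Real.log n := Real.log_nonneg (by exact_mod_cast hn)
  have hn' : (0 : ℝ) < n := by exact_mod_cast hn
  refine Real.sqrt_le_iff.2 ⟨by positivity, ?_⟩
  refine (variance_pi_le_of_bounded_differences ν n _ hm hC plugIn_update_sub_le).trans_eq ?_
  rw [div_pow _ (√(n : ℝ)), Real.sq_sqrt hn'.le]
  field_simp

/-! ### Moments of the empirical frequencies -/

theorem mass_le_one (μ : PMF ℕ) (j : ℕ) : mass μ j ≤ 1 := by
  have := ENNReal.toNNReal_mono ENNReal.one_ne_top (μ.coe_le_one j)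
  simpa [mass] using this

theorem coe_mass (μ : PMF ℕ) (j : ℕ) : (mass μ j : ℝ≥0∞) = μ j :=
  ENNReal.coe_toNNReal (μ.apply_ne_top j)

theorem ofReal_mass (μ : PMF ℕ) (j : ℕ) : ENNReal.ofReal (mass μ j) = μ j := by
  rw [ENNReal.ofReal_coe_nnreal, coe_mass]

/-- The law of `n` independent observations from `μ`. -/
noncomputable abbrev sampleLaw (n : ℕ) (μ : PMF ℕ) : Measure (Fin n → ℕ) :=
  Measure.pi fun _ : Fin n => μ.toMeasure

/-- A sum of functions of independent coordinates, so that means and variances add. -/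
theorem coe_empirical_eq_sum {n : ℕ} (j : ℕ) :
    (fun x : Fin n → ℕ => (empirical x j : ℝ)) =
      ∑ i : Fin n, fun x => (fun a => Set.indicator {j} (fun _ => (n : ℝ)⁻¹) a) (x i) := by
  ext x
  simp [coe_empirical, count, Set.indicator_apply, div_eq_mul_inv, Finset.sum_ite]

theorem integral_indicator_mass (μ : PMF ℕ) (j : ℕ) (c : ℝ) :
    ∫ a, Set.indicator {j} (fun _ => c) a ∂μ.toMeasure = mass μ j * c := by
  rw [integral_indicator_const _ (measurableSet_singleton j), measureReal_def,
    μ.toMeasure_apply_singleton j (measurableSet_singleton j)]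
  rfl

theorem integrable_of_discrete {n : ℕ} (μ : PMF ℕ) {f : (Fin n → ℕ) → ℝ} {C : ℝ}
    (hC : ∀ x, |f x| ≤ C) : Integrable f (sampleLaw n μ) :=
  Integrable.of_bound Measurable.of_discrete.aestronglyMeasurable C
    (Filter.Eventually.of_forall hC)

theorem abs_empirical_le {n : ℕ} (x : Fin n → ℕ) (j : ℕ) : |(empirical x j : ℝ)| ≤ 1 := by
  rw [abs_of_nonneg (empirical x j).coe_nonneg]
  exact_mod_cast empirical_le_one x j

theorem integral_empirical {n : ℕ} (hn : 0 < n) (μ : PMF ℕ) (j : ℕ) :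
    ∫ x : Fin n → ℕ, (empirical x j : ℝ) ∂sampleLaw n μ = mass μ j := by
  have hn' : (n : ℝ) ≠ 0 := by positivity
  have h := congrFun (coe_empirical_eq_sum (n := n) j)
  simp only [Finset.sum_apply] at h
  simp_rw [h]
  rw [integral_finsetSum]
  · have h1 : ∀ i : Fin n, ∫ x : Fin n → ℕ, Set.indicator {j} (fun _ => (n : ℝ)⁻¹) (x i)
        ∂sampleLaw n μ = mass μ j * (n : ℝ)⁻¹ := fun i => by
      rw [← integral_indicator_mass]
      exact integral_comp_eval (μ := fun _ : Fin n => μ.toMeasure) (i := i)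
        (f := Set.indicator {j} fun _ => (n : ℝ)⁻¹) Measurable.of_discrete.aestronglyMeasurable
    simp_rw [h1]
    simp
    field_simp
  · intro i _
    refine integrable_of_discrete μ (C := (n : ℝ)⁻¹) fun x => ?_
    by_cases hx : x i = j <;> simp [hx]

theorem variance_empirical_le {n : ℕ} (hn : 0 < n) (μ : PMF ℕ) (j : ℕ) :
    variance (fun x : Fin n → ℕ => (empirical x j : ℝ)) (sampleLaw n μ) ≤ mass μ j / n := by
  have hn' : (n : ℝ) ≠ 0 := by positivity
  rw [coe_empirical_eq_sum, variance_sum_pi]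
  · have h1 : variance (fun a => Set.indicator {j} (fun _ => (n : ℝ)⁻¹) a) μ.toMeasure ≤
        mass μ j * ((n : ℝ)⁻¹) ^ 2 := by
      refine (variance_le_expectation_sq Measurable.of_discrete.aestronglyMeasurable).trans_eq ?_
      rw [← integral_indicator_mass]
      congr 1
      ext a
      by_cases ha : a = j <;> simp [Set.indicator_apply, ha]
    refine (Finset.sum_le_sum fun i _ => h1).trans_eq ?_
    simp
    field_simp
  · intro i
    refine MemLp.of_bound Measurable.of_discrete.aestronglyMeasurable ((n : ℝ)⁻¹)
      (Filter.Eventually.of_forall fun a => ?_)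
    by_cases ha : a = j <;> simp [ha]

theorem integral_empirical_sq_le {n : ℕ} (hn : 0 < n) (μ : PMF ℕ) (j : ℕ) :
    ∫ x : Fin n → ℕ, (empirical x j : ℝ) ^ 2 ∂sampleLaw n μ ≤
      (mass μ j : ℝ) ^ 2 + mass μ j / n := by
  have h := variance_empirical_le hn μ j
  rw [variance_eq_sub (MemLp.of_bound Measurable.of_discrete.aestronglyMeasurable 1
    (Filter.Eventually.of_forall fun x => abs_empirical_le x j)), integral_empirical hn] at h
  simp only [Pi.pow_apply] at h
  linarith

/-! ### Bias of the plug-in estimator -/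

/-- The right-hand side is the tangent of the concave function -x log x at q. Being affine in x, it
integrates using the mean alone. -/
theorem negMulLog_le_tangent {x q : ℝ} (hx : 0 ≤ x) (hq : 0 < q) :
    Real.negMulLog x ≤ -x * Real.log q + q - x := by
  rcases hx.eq_or_lt with rfl | hx
  · simpa using hq.le
  · have h := Real.log_le_sub_one_of_pos (div_pos hq hx)
    rw [Real.log_div hq.ne' hx.ne'] at h
    have h2 := mul_le_mul_of_nonneg_left h hx.le
    rw [mul_sub, mul_sub, mul_div_cancel₀ _ hx.ne'] at h2
    rw [Real.negMulLog]
    linarith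

/-- The left-hand side touches -x log x at x = q, and its expectation needs only two moments. The
inequality is log t ≤ t - 1 at t = x/q. -/
theorem parabola_le_negMulLog {x q : ℝ} (hx : 0 ≤ x) (hq : 0 < q) :
    -x * Real.log q - x ^ 2 / q + x ≤ Real.negMulLog x := by
  rcases hx.eq_or_lt with rfl | hx
  · simp
  · have h := Real.log_le_sub_one_of_pos (div_pos hx hq)
    rw [Real.log_div hx.ne' hq.ne'] at h
    have h2 := mul_le_mul_of_nonneg_left h hx.le
    have h3 : x * (x / q - 1) = x ^ 2 / q - x := by ring
    rw [h3] at h2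
    rw [Real.negMulLog]
    linarith

theorem negMulLog_empirical_nonneg {n : ℕ} (x : Fin n → ℕ) (j : ℕ) :
    0 ≤ Real.negMulLog (empirical x j) :=
  Real.negMulLog_nonneg (empirical x j).coe_nonneg (by exact_mod_cast empirical_le_one x j)

theorem integrable_negMulLog_empirical {n : ℕ} (μ : PMF ℕ) (j : ℕ) :
    Integrable (fun x : Fin n → ℕ => Real.negMulLog (empirical x j)) (sampleLaw n μ) := by
  refine integrable_of_discrete μ (C := 1) fun x => ?_
  rw [abs_of_nonneg (negMulLog_empirical_nonneg x j)]
  have := negMulLog_le_tangent (empirical x j).coe_nonneg one_pos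
  have h0 := (empirical x j).coe_nonneg
  simp only [Real.log_one, mul_zero] at this
  linarith

theorem integral_negMulLog_empirical_le {n : ℕ} (hn : 0 < n) (μ : PMF ℕ) (j : ℕ) :
    ∫ x : Fin n → ℕ, Real.negMulLog (empirical x j) ∂sampleLaw n μ ≤
      Real.negMulLog (mass μ j) := by
  have hint : Integrable (fun x : Fin n → ℕ => (empirical x j : ℝ)) (sampleLaw n μ) :=
    integrable_of_discrete μ fun x => abs_empirical_le x j
  have key : ∀ q : ℝ, 0 < q → ∫ x : Fin n → ℕ, Real.negMulLog (empirical x j) ∂sampleLaw n μ ≤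
      -(mass μ j) * Real.log q + q - mass μ j := by
    intro q hq
    have hlin : Integrable (fun x : Fin n → ℕ => -(empirical x j : ℝ) * Real.log q)
        (sampleLaw n μ) := hint.neg.mul_const _
    have hadd : Integrable (fun x : Fin n → ℕ => -(empirical x j : ℝ) * Real.log q + q)
        (sampleLaw n μ) := hlin.add (integrable_const q)
    calc _ ≤ ∫ x : Fin n → ℕ, (-(empirical x j : ℝ) * Real.log q + q - empirical x j)
          ∂sampleLaw n μ :=
          integral_mono (integrable_negMulLog_empirical μ j)
            (hadd.sub hint) fun x => negMulLog_le_tangent (empirical x j).coe_nonneg hq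
      _ = _ := by
          rw [integral_sub hadd hint, integral_add hlin (integrable_const q),
            integral_mul_const, integral_neg, integral_empirical hn]
          simp
  -- The best choice is q equal to the mass. If the mass is 0, `key` bounds the integral by every q
  -- > 0.
  rcases (mass μ j).coe_nonneg.eq_or_lt with h | h
  · rw [← h] at key ⊢
    refine le_of_forall_pos_le_add fun q hq => ?_
    simpa using key q hq
  · refine (key _ h).trans_eq ?_
    rw [Real.negMulLog]
    ring

/-- Integrate the parabola at q = p: since the second moment is at most p² + p/n, its quadratic term
costs at most p + 1/n, and the linear term returns p. -/
theorem negMulLog_mass_le {n : ℕ} (hn : 0 < n) (μ : PMF ℕ) {j : ℕ} (hj : 0 < (mass μ j : ℝ)) :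
    Real.negMulLog (mass μ j) ≤
      ∫ x : Fin n → ℕ, Real.negMulLog (empirical x j) ∂sampleLaw n μ + 1 / n := by
  have hint : Integrable (fun x : Fin n → ℕ => (empirical x j : ℝ)) (sampleLaw n μ) :=
    integrable_of_discrete μ fun x => abs_empirical_le x j
  have hint2 : Integrable (fun x : Fin n → ℕ => (empirical x j : ℝ) ^ 2) (sampleLaw n μ) :=
    integrable_of_discrete μ (C := 1) fun x => by
      rw [abs_pow]
      exact pow_le_one₀ (abs_nonneg _) (abs_empirical_le x j)
  have hlin : Integrable (fun x : Fin n → ℕ => -(empirical x j : ℝ) * Real.log (mass μ j))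
      (sampleLaw n μ) := hint.neg.mul_const _
  have hsub : Integrable (fun x : Fin n → ℕ => -(empirical x j : ℝ) * Real.log (mass μ j) -
      (empirical x j : ℝ) ^ 2 / mass μ j) (sampleLaw n μ) := hlin.sub (hint2.div_const _)
  have h1 : ∫ x : Fin n → ℕ, (-(empirical x j : ℝ) * Real.log (mass μ j) -
      (empirical x j : ℝ) ^ 2 / mass μ j + empirical x j) ∂sampleLaw n μ ≤
      ∫ x : Fin n → ℕ, Real.negMulLog (empirical x j) ∂sampleLaw n μ :=
    integral_mono (hsub.add hint)
      (integrable_negMulLog_empirical μ j) fun x =>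
        parabola_le_negMulLog (empirical x j).coe_nonneg hj
  rw [integral_add hsub hint, integral_sub hlin (hint2.div_const _), integral_mul_const, integral_div,
    integral_neg, integral_empirical hn] at h1
  have h2 : (∫ x : Fin n → ℕ, (empirical x j : ℝ) ^ 2 ∂sampleLaw n μ) / mass μ j ≤
      ((mass μ j : ℝ) ^ 2 + mass μ j / n) / mass μ j := by
    gcongr
    exact integral_empirical_sq_le hn μ j
  have h3 : ((mass μ j : ℝ) ^ 2 + mass μ j / n) / mass μ j = mass μ j + 1 / n := by
    field_simp
  rw [Real.negMulLog]
  linarith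

theorem lintegral_negMulLog_empirical {n : ℕ} (μ : PMF ℕ) (j : ℕ) :
    ∫⁻ x : Fin n → ℕ, ENNReal.ofReal (Real.negMulLog (empirical x j)) ∂sampleLaw n μ =
      ENNReal.ofReal (∫ x : Fin n → ℕ, Real.negMulLog (empirical x j) ∂sampleLaw n μ) :=
  (ofReal_integral_eq_lintegral_ofReal (integrable_negMulLog_empirical μ j)
    (Filter.Eventually.of_forall fun x => negMulLog_empirical_nonneg x j)).symm

theorem lintegral_plugIn {n : ℕ} (μ : PMF ℕ) :
    ∫⁻ x : Fin n → ℕ, (plugIn x : ℝ≥0∞) ∂sampleLaw n μ =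
      ∑' j, ∫⁻ x : Fin n → ℕ, ENNReal.ofReal (Real.negMulLog (empirical x j)) ∂sampleLaw n μ := by
  rw [← lintegral_tsum fun j => Measurable.of_discrete.aemeasurable]
  refine lintegral_congr fun x => ?_
  rw [coe_plugIn, entropy_eq_tsum (empirical_le_one x)]

/-- The plug-in estimator is biased downwards. -/
theorem lintegral_plugIn_le {n : ℕ} (hn : 0 < n) (μ : PMF ℕ) :
    ∫⁻ x : Fin n → ℕ, (plugIn x : ℝ≥0∞) ∂sampleLaw n μ ≤ entropy (mass μ) := by
  rw [lintegral_plugIn, entropy_eq_tsum (mass_le_one μ)]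
  refine ENNReal.tsum_le_tsum fun j => ?_
  rw [lintegral_negMulLog_empirical]
  exact ENNReal.ofReal_le_ofReal (integral_negMulLog_empirical_le hn μ j)

/-- Here |log p| ≥ (log n)/2, so the factor (2 |log p| / log n)^(α-1) is at least 1 and may be
inserted. -/
theorem negMulLog_le_of_lt_inv_sqrt {n : ℕ} (hn : 2 ≤ n) {α p : ℝ} (hα : 1 < α) (hp : 0 < p)
    (hpn : p < 1 / √n) :
    Real.negMulLog p ≤ (2 / Real.log n) ^ (α - 1) * (p * |Real.log p| ^ α) := by
  have hn' : (1 : ℝ) < n := by exact_mod_cast hn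
  have hL : 0 < Real.log n := Real.log_pos hn'
  have h1 : Real.log p ≤ -(Real.log n / 2) := by
    have := Real.log_le_log hp hpn.le
    rwa [one_div, Real.log_inv, Real.log_sqrt (by linarith)] at this
  have h2 : |Real.log p| = -Real.log p := abs_of_nonpos (by linarith)
  have h3 : 0 < |Real.log p| := by linarith
  have h4 : 1 ≤ (2 / Real.log n * |Real.log p|) ^ (α - 1) := by
    refine Real.one_le_rpow ?_ (by linarith)
    rw [div_mul_eq_mul_div, one_le_div hL]
    linarith
  have h5 : |Real.log p| ^ α = |Real.log p| ^ (α - 1) * |Real.log p| := by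
    rw [← Real.rpow_add_one h3.ne', sub_add_cancel]
  rw [Real.mul_rpow (by positivity) h3.le] at h4
  calc Real.negMulLog p = p * |Real.log p| * 1 := by rw [h2, Real.negMulLog]; ring
    _ ≤ p * |Real.log p| * ((2 / Real.log n) ^ (α - 1) * |Real.log p| ^ (α - 1)) := by gcongr
    _ = _ := by rw [h5]; ring

/-- The bias of the plug-in estimator: symbols of mass at least `1 / √n` contribute at most `1 / n`
each, and the information of the others is controlled by the `α`-th moment. -/
theorem entropy_le_lintegral_plugIn_add {n : ℕ} (hn : 2 ≤ n) {α : ℝ} (hα : 1 < α) (μ : PMF ℕ) :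
    entropy (mass μ) ≤ ∫⁻ x : Fin n → ℕ, (plugIn x : ℝ≥0∞) ∂sampleLaw n μ +
      (ENNReal.ofReal (1 / √n) +
        ENNReal.ofReal ((2 / Real.log n) ^ (α - 1)) * infoMoment α (mass μ)) := by
  have hn0 : (0 : ℝ) < n := by exact_mod_cast (by omega : 0 < n)
  -- Spreading 1/√n over the symbols in proportion to their mass lets the inequality be checked
  -- termwise.
  have h1 : ENNReal.ofReal (1 / √n) = ∑' j, ENNReal.ofReal (1 / √n) * μ j := by
    rw [ENNReal.tsum_mul_left, μ.tsum_coe, mul_one]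
  rw [lintegral_plugIn, entropy_eq_tsum (mass_le_one μ), infoMoment, h1,
    ← ENNReal.tsum_mul_left, ← ENNReal.tsum_add, ← ENNReal.tsum_add]
  refine ENNReal.tsum_le_tsum fun j => ?_
  rcases (mass μ j).coe_nonneg.eq_or_lt with h | h
  · rw [← h]; simp
  by_cases hj : (mass μ j : ℝ) < 1 / √n
  · refine le_trans ?_ (le_add_self.trans le_add_self)
    rw [← ENNReal.ofReal_mul' (by positivity)]
    exact ENNReal.ofReal_le_ofReal (negMulLog_le_of_lt_inv_sqrt hn hα h hj)
  · refine le_trans ?_ (add_le_add_right le_self_add _)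
    rw [← ofReal_mass, ← ENNReal.ofReal_mul (by positivity), lintegral_negMulLog_empirical,
      ← ENNReal.ofReal_add (integral_nonneg fun x => negMulLog_empirical_nonneg x j)
        (by positivity)]
    refine ENNReal.ofReal_le_ofReal ((negMulLog_mass_le (n := n) (by omega) μ h).trans ?_)
    refine add_le_add_right ?_ _
    calc (1 : ℝ) / n = 1 / √n * (1 / √n) := by
          rw [div_mul_div_comm, Real.mul_self_sqrt hn0.le, one_mul]
      _ ≤ _ := by
          gcongr
          exact not_lt.1 hj

/-! ### Risk of the plug-in estimator -/

theorem ofReal_tsub_add_tsub (a b : ℝ) (ha : 0 ≤ a) (hb : 0 ≤ b) :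
    (ENNReal.ofReal a - ENNReal.ofReal b) + (ENNReal.ofReal b - ENNReal.ofReal a) =
      ENNReal.ofReal |a - b| := by
  rw [← ENNReal.ofReal_sub _ hb, ← ENNReal.ofReal_sub _ ha]
  rcases le_total a b with h | h
  · rw [ENNReal.ofReal_of_nonpos (sub_nonpos.2 h), zero_add, abs_of_nonpos (sub_nonpos.2 h),
      neg_sub]
  · rw [ENNReal.ofReal_of_nonpos (sub_nonpos.2 h), add_zero, abs_of_nonneg (sub_nonneg.2 h)]

theorem risk_plugIn_le {n : ℕ} (hn : 2 ≤ n) {α : ℝ} (hα : 1 < α) (μ : PMF ℕ) :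
    risk (plugIn (n := n)) μ ≤ ENNReal.ofReal ((1 + Real.log n) / √n) +
      ENNReal.ofReal ((2 / Real.log n) ^ (α - 1)) * infoMoment α (mass μ) := by
  have hn0 : 0 < n := by omega
  set B := ENNReal.ofReal (1 / √n) +
    ENNReal.ofReal ((2 / Real.log n) ^ (α - 1)) * infoMoment α (mass μ) with hB
  set m := ∫ x : Fin n → ℕ, (plugIn x : ℝ) ∂sampleLaw n μ with hm
  have hint : Integrable (fun x : Fin n → ℕ => (plugIn x : ℝ)) (sampleLaw n μ) :=
    integrable_of_discrete μ (C := n) fun x => by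
      rw [abs_of_nonneg (plugIn x).coe_nonneg]
      exact plugIn_le x
  have hm0 : 0 ≤ m := integral_nonneg fun x => (plugIn x).coe_nonneg
  have hmL : ∫⁻ x : Fin n → ℕ, (plugIn x : ℝ≥0∞) ∂sampleLaw n μ = ENNReal.ofReal m := by
    rw [hm, ofReal_integral_eq_lintegral_ofReal hint
      (Filter.Eventually.of_forall fun x => (plugIn x).coe_nonneg)]
    simp_rw [ENNReal.ofReal_coe_nnreal]
  have hlow := lintegral_plugIn_le hn0 μ
  have hup := entropy_le_lintegral_plugIn_add hn hα μ
  rw [hmL] at hlow hup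
  -- This is the triangle inequality through `m`, using m ≤ H ≤ m + B. Truncated differences keep it
  -- valid when H and B are infinite.
  have hpt : ∀ x : Fin n → ℕ, absDiff (plugIn x : ℝ≥0∞) (entropy (mass μ)) ≤
      ENNReal.ofReal |(plugIn x : ℝ) - m| + B := by
    intro x
    rw [← ofReal_tsub_add_tsub _ _ (plugIn x).coe_nonneg hm0, ENNReal.ofReal_coe_nnreal, absDiff,
      add_assoc]
    refine add_le_add (tsub_le_tsub_left hlow _) ?_
    refine (tsub_le_tsub_right hup _).trans ?_
    rw [tsub_le_iff_right]
    calc ENNReal.ofReal m + B ≤ (ENNReal.ofReal m - plugIn x + plugIn x) + B := by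
          gcongr
          exact le_tsub_add
      _ = _ := by ring
  calc risk (plugIn (n := n)) μ
      ≤ ∫⁻ x, (ENNReal.ofReal |(plugIn x : ℝ) - m| + B) ∂sampleLaw n μ := lintegral_mono hpt
    _ = ENNReal.ofReal (∫ x, |(plugIn x : ℝ) - m| ∂sampleLaw n μ) + B := by
        have habs : Integrable (fun x : Fin n → ℕ => |(plugIn x : ℝ) - m|) (sampleLaw n μ) :=
          (hint.sub (integrable_const m)).abs
        rw [lintegral_add_right _ measurable_const, lintegral_const, measure_univ, mul_one,
          ofReal_integral_eq_lintegral_ofReal habs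
            (Filter.Eventually.of_forall fun x => abs_nonneg _)]
    _ ≤ ENNReal.ofReal (Real.log n / √n) + B := by
        gcongr
        exact integral_abs_plugIn_sub_le hn0 μ.toMeasure
    _ = _ := by
        have hlog : 0 ≤ Real.log n := Real.log_nonneg (by exact_mod_cast hn0)
        rw [hB, ← add_assoc, ← ENNReal.ofReal_add (by positivity) (by positivity), ← add_div,
          add_comm (Real.log (n : ℝ))]

theorem worstCaseRisk_plugIn_le {α h : ℝ} (hα : 1 < α) (hh : 0 < h) {n : ℕ} (hn : 1 ≤ n) :
    worstCaseRisk α h (plugIn (n := n)) ≤ ENNReal.ofReal ((1 + Real.log n) / √(n : ℝ)) +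
      ENNReal.ofReal (2 ^ (α - 1) * h) / ENNReal.ofReal (Real.log n) ^ (α - 1) := by
  rcases hn.eq_or_lt with rfl | hn
  · have h1 : ENNReal.ofReal (2 ^ (α - 1) * h) ≠ 0 := by
      rw [Ne, ENNReal.ofReal_eq_zero, not_le]
      positivity
    rw [Nat.cast_one, Real.log_one, ENNReal.ofReal_zero, ENNReal.zero_rpow_of_pos (by linarith),
      ENNReal.div_zero h1, add_top]
    exact le_top
  · have hL : 0 < Real.log n := Real.log_pos (by exact_mod_cast hn)
    have h1 : ENNReal.ofReal (2 ^ (α - 1) * h) / ENNReal.ofReal (Real.log n) ^ (α - 1) =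
        ENNReal.ofReal ((2 / Real.log n) ^ (α - 1)) * ENNReal.ofReal h := by
      rw [ENNReal.ofReal_rpow_of_pos hL, ← ENNReal.ofReal_div_of_pos (by positivity),
        ← ENNReal.ofReal_mul (by positivity), Real.div_rpow (by norm_num) hL.le]
      congr 1
      ring
    rw [h1]
    refine iSup₂_le fun μ hμ => (risk_plugIn_le hn hα μ).trans ?_
    gcongr
    exact hμ

/-! ### Lower bound by two points -/

/-- Only the constant sample 0, of probability μ(0)^n, is kept in the integral. -/
theorem pow_mul_absDiff_le_risk {n : ℕ} (Hhat : (Fin n → ℕ) → ℝ≥0) (μ : PMF ℕ) :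
    μ 0 ^ n * absDiff (Hhat 0) (entropy (mass μ)) ≤ risk Hhat μ := by
  have h1 : sampleLaw n μ {0} = μ 0 ^ n := by
    rw [Measure.pi_singleton]
    simp [μ.toMeasure_apply_singleton 0 (measurableSet_singleton 0)]
  calc μ 0 ^ n * absDiff (Hhat 0) (entropy (mass μ))
      = ∫⁻ x in {0}, absDiff (Hhat x) (entropy (mass μ)) ∂sampleLaw n μ := by
        rw [lintegral_singleton, h1, mul_comm]
    _ ≤ _ := setLIntegral_le_lintegral _ _

theorem infoMoment_pure {α : ℝ} (hα : 0 < α) : infoMoment α (mass (PMF.pure 0)) = 0 := by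
  refine ENNReal.tsum_eq_zero.2 fun j => ?_
  by_cases hj : j = 0
  · subst hj
    simp [mass, Real.zero_rpow hα.ne']
  · simp [mass, hj]

/-- Le Cam's two-point bound for the point mass at `0` and a distribution which is likely to produce
the constant sample `0`. -/
theorem entropy_div_four_le_minimaxRisk {n : ℕ} {α h : ℝ} (hα : 0 < α) {μ : PMF ℕ}
    (hμ : μ ∈ boundedMoment α h) (h0 : 1 / 2 ≤ μ 0 ^ n) :
    entropy (mass μ) / 4 ≤ minimaxRisk n α h := by
  refine le_iInf fun Hhat => ENNReal.div_le_of_le_mul ?_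
  have hp : PMF.pure 0 ∈ boundedMoment α h := by
    simp [boundedMoment, infoMoment_pure hα]
  have h1 : (Hhat 0 : ℝ≥0∞) ≤ worstCaseRisk α h Hhat := by
    refine le_trans ?_ ((pow_mul_absDiff_le_risk Hhat (PMF.pure 0)).trans
      (le_iSup₂_of_le (PMF.pure 0) hp le_rfl))
    simp [absDiff, entropy, infoMoment_pure one_pos]
  have h2 : 1 / 2 * (entropy (mass μ) - Hhat 0) ≤ worstCaseRisk α h Hhat :=
    (mul_le_mul' h0 le_add_self).trans
      ((pow_mul_absDiff_le_risk Hhat μ).trans (le_iSup₂_of_le μ hμ le_rfl))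
  set W := worstCaseRisk α h Hhat
  have h3 : entropy (mass μ) - Hhat 0 ≤ W * 2 := by
    rw [one_div, ← ENNReal.div_eq_inv_mul] at h2
    exact (ENNReal.div_le_iff_le_mul (Or.inl two_ne_zero) (Or.inl ENNReal.ofNat_ne_top)).1 h2
  -- The argument yields H ≤ 3W; one more W is given away to reach the constant 4.
  calc entropy (mass μ) ≤ (entropy (mass μ) - Hhat 0) + Hhat 0 := le_tsub_add
    _ ≤ W * 2 + W := add_le_add h3 h1
    _ ≤ W * 2 + W + W := le_self_add
    _ = W * 4 := by ring

/-! ### The spike family and its parameters -/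

/-- Mass `1 - ε` at `0`, the remaining mass `ε` spread evenly over `1, …, m`. -/
noncomputable def spike (ε : ℝ) (h0 : 0 ≤ ε) (h1 : ε ≤ 1) (m : ℕ) (hm : 0 < m) : PMF ℕ :=
  PMF.ofFinset (fun j => if j = 0 then ENNReal.ofReal (1 - ε) else
      if j ≤ m then ENNReal.ofReal (ε / m) else 0) (Finset.range (m + 1)) (by
    rw [Finset.sum_range_succ', Finset.sum_congr rfl (g := fun _ => ENNReal.ofReal (ε / m))]
    · rw [Finset.sum_const, Finset.card_range, nsmul_eq_mul, if_pos rfl,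
        ← ENNReal.ofReal_natCast, ← ENNReal.ofReal_mul (Nat.cast_nonneg m),
        ← ENNReal.ofReal_add (by positivity) (by linarith)]
      have : (m : ℝ) ≠ 0 := by positivity
      rw [mul_div_cancel₀ _ this]
      simp
    · intro j hj
      have := Finset.mem_range.1 hj
      rw [if_neg (by omega), if_pos (by omega)]) (by
    intro j hj
    have := Finset.mem_range.not.1 hj
    rw [if_neg (by omega), if_neg (by omega)])

variable {ε : ℝ} {h0 : 0 ≤ ε} {h1 : ε ≤ 1} {m : ℕ} {hm : 0 < m}

theorem spike_zero : spike ε h0 h1 m hm 0 = ENNReal.ofReal (1 - ε) := by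
  simp [spike, PMF.ofFinset_apply]

theorem mass_spike_zero : (mass (spike ε h0 h1 m hm) 0 : ℝ) = 1 - ε := by
  rw [mass, spike_zero]
  exact ENNReal.toReal_ofReal (by linarith)

theorem mass_spike_of_le {j : ℕ} (hj : 0 < j) (hjm : j ≤ m) :
    (mass (spike ε h0 h1 m hm) j : ℝ) = ε / m := by
  rw [mass, spike, PMF.ofFinset_apply, if_neg hj.ne', if_pos hjm]
  exact ENNReal.toReal_ofReal (by positivity)

theorem mass_spike_of_lt {j : ℕ} (hjm : m < j) : mass (spike ε h0 h1 m hm) j = 0 := by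
  rw [mass, spike, PMF.ofFinset_apply, if_neg (by omega), if_neg (by omega)]
  simp

theorem infoMoment_spike (α : ℝ) : infoMoment α (mass (spike ε h0 h1 m hm)) =
    ENNReal.ofReal ((1 - ε) * |Real.log (1 - ε)| ^ α + ε * |Real.log (ε / m)| ^ α) := by
  have hm' : (m : ℝ) ≠ 0 := by positivity
  have h1' : 0 ≤ 1 - ε := by linarith
  rw [infoMoment, tsum_eq_sum (s := Finset.range (m + 1))]
  · rw [Finset.sum_range_succ', mass_spike_zero, Finset.sum_congr rfl
      (g := fun _ => ENNReal.ofReal (ε / m * |Real.log (ε / m)| ^ α))]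
    · rw [Finset.sum_const, Finset.card_range, nsmul_eq_mul, ← ENNReal.ofReal_natCast,
        ← ENNReal.ofReal_mul (Nat.cast_nonneg m),
        ← ENNReal.ofReal_add (by positivity) (by positivity), ← mul_assoc,
        mul_div_cancel₀ _ hm', add_comm]
    · intro j hj
      have := Finset.mem_range.1 hj
      rw [mass_spike_of_le (by omega) (by omega)]
  · intro j hj
    have := Finset.mem_range.not.1 hj
    rw [mass_spike_of_lt (by omega)]
    simp

/-- Bernoulli's inequality; ε = 1/(2n) makes its lower bound exactly 1/2. -/
theorem half_le_spike_zero_pow {n : ℕ} (hn : 0 < n) (hε : ε = 1 / (2 * n)) :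
    1 / 2 ≤ spike ε h0 h1 m hm 0 ^ n := by
  have hn' : (n : ℝ) ≠ 0 := by positivity
  have := one_add_mul_le_pow (a := -ε) (by linarith) n
  have h2 : 1 + (n : ℝ) * -ε = 1 / 2 := by
    rw [hε]
    field_simp
    norm_num
  rw [spike_zero, ← ENNReal.ofReal_pow (by linarith)]
  calc (1 / 2 : ℝ≥0∞) = ENNReal.ofReal (1 / 2) := by
        rw [ENNReal.ofReal_div_of_pos two_pos]
        simp
    _ ≤ _ := ENNReal.ofReal_le_ofReal (by rw [← h2]; simpa [sub_eq_add_neg] using this)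

/-- With h the α-th moment of the spike, `hle` reads h ≤ 3^α ℓ H, which turns H/4 into the claimed
bound. The real number `ℓ` stands for (log n)^(α-1), so that n = α = 1 fits with ℓ = 1. -/
theorem exists_minimaxRisk_lower_bound {n : ℕ} (hn : 0 < n) {α ℓ : ℝ} (hα : 0 < α) (hℓ : 0 < ℓ)
    (hL : ENNReal.ofReal (Real.log n) ^ (α - 1) = ENNReal.ofReal ℓ) (hε : ε = 1 / (2 * n))
    (hm : 0 < m)
    (hle : (1 - ε) * |Real.log (1 - ε)| ^ α + ε * |Real.log (ε / m)| ^ α ≤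
      3 ^ α * ℓ * ((1 - ε) * |Real.log (1 - ε)| + ε * |Real.log (ε / m)|)) :
    ∃ h : ℝ, 0 < h ∧
      ENNReal.ofReal h / (4 * 3 ^ α * ENNReal.ofReal (Real.log n) ^ (α - 1)) ≤
        minimaxRisk n α h := by
  have hn1 : (1 : ℝ) ≤ n := by exact_mod_cast hn
  have hε0 : 0 < ε := by rw [hε]; positivity
  have hε1 : ε ≤ 1 / 2 := by
    rw [hε, div_le_div_iff₀ (by positivity) two_pos]
    linarith
  -- The witness `h` is found by unification with the moment in `infoMoment_spike`.
  refine ⟨_, ?_, le_trans ?_ (entropy_div_four_le_minimaxRisk hα (infoMoment_spike (ε := ε)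
    (h0 := hε0.le) (h1 := by linarith) (m := m) (hm := hm) α).le (half_le_spike_zero_pow hn hε))⟩
  · have : Real.log (1 - ε) < 0 := Real.log_neg (by linarith) (by linarith)
    have h2 : 0 < |Real.log (1 - ε)| := abs_pos.2 this.ne
    have h3 : 0 < 1 - ε := by linarith
    positivity
  · have h3 : (3 : ℝ≥0∞) ^ α = ENNReal.ofReal (3 ^ α) := by
      rw [← ENNReal.ofReal_rpow_of_pos three_pos]
      simp
    rw [entropy, infoMoment_spike, hL, h3]
    simp only [Real.rpow_one]
    rw [mul_assoc, ← ENNReal.ofReal_mul (by positivity), ENNReal.le_div_iff_mul_le (by simp) (by simp)]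
    have h4 : (4 : ℝ≥0∞) = ENNReal.ofReal 4 := by simp
    rw [h4, ← ENNReal.ofReal_mul (by norm_num), ← ENNReal.ofReal_div_of_pos (by positivity),
      ← ENNReal.ofReal_mul' (by norm_num)]
    refine ENNReal.ofReal_le_ofReal ?_
    rw [div_mul_eq_mul_div, div_le_iff₀ (by positivity)]
    linarith

theorem rpow_le_of_le {α x b : ℝ} (hα : 1 ≤ α) (hx : 0 < x) (hxb : x ≤ b) :
    x ^ α ≤ b ^ (α - 1) * x := by
  have : x ^ α = x ^ (α - 1) * x := by rw [← Real.rpow_add_one hx.ne', sub_add_cancel]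
  rw [this]
  gcongr

/-- For α ≥ 1, m = 1 works: both logarithms are at most 3 log n in absolute value, and x^α ≤ (3 log
n)^(α-1) x for such x > 0. For α < 1, T = log(2nm) tends to infinity with m, so T^α becomes
negligible against T. -/
theorem exists_width {n : ℕ} (hn : 2 ≤ n) {α : ℝ} (hα : 0 < α) (hε : ε = 1 / (2 * n)) :
    ∃ m : ℕ, 0 < m ∧ (1 - ε) * |Real.log (1 - ε)| ^ α + ε * |Real.log (ε / m)| ^ α ≤
      3 ^ α * Real.log n ^ (α - 1) *
        ((1 - ε) * |Real.log (1 - ε)| + ε * |Real.log (ε / m)|) := by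
  have hn2 : (2 : ℝ) ≤ n := by exact_mod_cast hn
  have hε0 : 0 < ε := by rw [hε]; positivity
  have hε1 : ε ≤ 1 / 2 := by
    rw [hε, div_le_div_iff₀ (by positivity) two_pos]
    linarith
  have hL : 0 < Real.log n := Real.log_pos (by linarith)
  have hs0 : 0 < |Real.log (1 - ε)| :=
    abs_pos.2 (Real.log_neg (by linarith) (by linarith)).ne
  have hs : |Real.log (1 - ε)| ≤ Real.log 2 := by
    rw [abs_of_nonpos (Real.log_nonpos (by linarith) (by linarith)), ← Real.log_inv]
    refine Real.log_le_log (inv_pos.2 (by linarith)) ?_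
    rw [inv_le_comm₀ (by linarith) two_pos]
    linarith
  have hT : ∀ m : ℕ, |Real.log (ε / m)| = |Real.log (2 * n * m)| := by
    intro m
    rw [hε, div_div, one_div, Real.log_inv, abs_neg]
  have h1ε : 0 ≤ 1 - ε := by linarith
  rcases le_or_gt 1 α with h | h
  · refine ⟨1, one_pos, ?_⟩
    rw [hT 1, Nat.cast_one, mul_one]
    have hT0 : 0 < Real.log (2 * n) := Real.log_pos (by linarith)
    have hlog2 : Real.log 2 ≤ Real.log n := Real.log_le_log two_pos hn2
    have hT3 : Real.log (2 * n) ≤ 3 * Real.log n := by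
      rw [Real.log_mul two_ne_zero (by linarith)]
      linarith
    rw [abs_of_pos hT0]
    have e1 := rpow_le_of_le h hs0 (b := 3 * Real.log n) (by linarith)
    have e2 := rpow_le_of_le h hT0 hT3
    have e3 : (3 * Real.log n) ^ (α - 1) ≤ 3 ^ α * Real.log n ^ (α - 1) := by
      rw [Real.mul_rpow (by norm_num) hL.le]
      gcongr
      · norm_num
      · linarith
    calc _ ≤ (1 - ε) * ((3 * Real.log n) ^ (α - 1) * |Real.log (1 - ε)|) +
          ε * ((3 * Real.log n) ^ (α - 1) * Real.log (2 * n)) := by gcongr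
      _ = (3 * Real.log n) ^ (α - 1) *
          ((1 - ε) * |Real.log (1 - ε)| + ε * Real.log (2 * n)) := by ring
      _ ≤ _ := by gcongr
  · set c : ℝ := 3 ^ α * Real.log n ^ (α - 1) with hc
    have hc0 : 0 < c := by positivity
    have hlim : Filter.Tendsto (fun m : ℕ => Real.log (2 * n * m)) Filter.atTop Filter.atTop :=
      Real.tendsto_log_atTop.comp
        (tendsto_natCast_atTop_atTop.const_mul_atTop (show (0 : ℝ) < 2 * n by positivity))
    -- The first bound gives ε T^α ≥ 1, which absorbs the term of the atom at 0; the second gives c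
    -- T^(1-α) ≥ 2, which pays for the resulting factor 2.
    obtain ⟨m, hm0, hm1, hm2⟩ := ((Filter.eventually_gt_atTop 0).and
      ((((tendsto_rpow_atTop hα).comp hlim).eventually_ge_atTop (1 / ε)).and
      (((tendsto_rpow_atTop (sub_pos.2 h)).comp hlim).eventually_ge_atTop (2 / c)))).exists
    simp only [Function.comp_apply] at hm1 hm2
    have hm' : (1 : ℝ) ≤ m := by exact_mod_cast hm0
    have hT0 : 0 < Real.log (2 * n * m) := Real.log_pos (by nlinarith)
    refine ⟨m, hm0, ?_⟩
    rw [hT m, abs_of_pos hT0]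
    set T := Real.log (2 * n * m)
    have e1 : T ^ α * T ^ (1 - α) = T := by
      rw [← Real.rpow_add hT0, add_sub_cancel, Real.rpow_one]
    have e2 : |Real.log (1 - ε)| ^ α ≤ 1 :=
      Real.rpow_le_one hs0.le (by linarith [Real.log_two_lt_d9]) hα.le
    have e3 : 1 ≤ ε * T ^ α := by
      rw [div_le_iff₀ hε0] at hm1
      linarith
    have e4 : 2 ≤ c * T ^ (1 - α) := by
      rw [div_le_iff₀ hc0] at hm2
      linarith
    have e5 : (1 - ε) * |Real.log (1 - ε)| ^ α ≤ 1 := mul_le_one₀ (by linarith) (by positivity) e2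
    calc _ ≤ 1 + ε * T ^ α := by gcongr
      _ ≤ ε * T ^ α * 2 := by linarith
      _ ≤ ε * T ^ α * (c * T ^ (1 - α)) := by gcongr
      _ = c * (ε * (T ^ α * T ^ (1 - α))) := by ring
      _ = c * (ε * T) := by rw [e1]
      _ ≤ _ := by
        gcongr
        have : 0 ≤ (1 - ε) * |Real.log (1 - ε)| := by positivity
        linarith

end EntropyEstimation

open EntropyEstimation in
/-- Risks and bounds take values in `[0, ∞]`, where `c / 0 = ∞` for `c > 0`, `c / ∞ = 0`, `0 ^ 0 = 1`,
and `0 ^ s = ∞` for `s < 0`. Thus the upper bound is `∞` for `n = 1`. The lower bound would be `∞`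
for `n = 1 < α`, where the risk is finite, so this case is excluded. -/
theorem theorem4 :
    (∀ α h : ℝ, 1 < α → 0 < h → ∀ n : ℕ, 1 ≤ n →
      minimaxRisk n α h ≤
          ENNReal.ofReal ((1 + Real.log n) / √(n : ℝ)) +
            ENNReal.ofReal (2 ^ (α - 1) * h) / ENNReal.ofReal (Real.log n) ^ (α - 1) ∧
        worstCaseRisk α h (plugIn (n := n)) ≤
          ENNReal.ofReal ((1 + Real.log n) / √(n : ℝ)) +
            ENNReal.ofReal (2 ^ (α - 1) * h) / ENNReal.ofReal (Real.log n) ^ (α - 1)) ∧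
    (∀ α : ℝ, 0 < α → ∀ n : ℕ, 1 ≤ n → (n = 1 → α ≤ 1) →
      ∃ h : ℝ, 0 < h ∧
        ENNReal.ofReal h / (4 * 3 ^ α * ENNReal.ofReal (Real.log n) ^ (α - 1)) ≤
          minimaxRisk n α h) := by
  refine ⟨fun α h hα hh n hn => ?_, fun α hα n hn h1 => ?_⟩
  · have := worstCaseRisk_plugIn_le hα hh hn
    exact ⟨(iInf_le _ _).trans this, this⟩
  · rcases hn.eq_or_lt with rfl | hn
    · rcases (h1 rfl).lt_or_eq with h | rfl
      -- Here 0^(α-1) = ∞, so the lower bound is 0 and any h > 0 serves.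
      · refine ⟨1, one_pos, ?_⟩
        have h3 : (4 : ℝ≥0∞) * 3 ^ α ≠ 0 := by simp
        rw [Nat.cast_one, Real.log_one, ENNReal.ofReal_zero,
          ENNReal.zero_rpow_of_neg (by linarith), ENNReal.mul_top h3, ENNReal.div_top]
        exact zero_le
      -- Since 0^0 = 1, ℓ = 1. The spike is a fair coin, and the moment condition reads x ≤ 3x.
      · refine exists_minimaxRisk_lower_bound (ε := 1 / (2 * (1 : ℕ))) (m := 1) one_pos one_pos
          one_pos (by simp) rfl one_pos ?_
        simp only [Real.rpow_one, mul_one]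
        refine le_mul_of_one_le_left (add_nonneg (mul_nonneg (by norm_num) (abs_nonneg _))
          (mul_nonneg (by norm_num) (abs_nonneg _))) (by norm_num)
    · have hL : 0 < Real.log n := Real.log_pos (by exact_mod_cast hn)
      obtain ⟨m, hm, hle⟩ := exists_width hn hα rfl
      exact exists_minimaxRisk_lower_bound (by omega) hα (by positivity)
        (ENNReal.ofReal_rpow_of_pos hL) rfl hm hle
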